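/- Conventions. Manifolds, metrics and maps are smooth. For a Riemannian manifold $(M,g)$ let $\Delta f=\frac{1}{\sqrt{\det g}}\,\partial_i\big(\sqrt{\det g}\,g^{ij}\,\partial_j f\big)$ be the Laplace–Beltrami operator. A smooth function $f$ is harmonic if $\Delta f=0$ and biharmonic if $\Delta(\Delta f)=0$; a map into $\mathbb{R}^n$ or $\mathbb{C}=\mathbb{R}^2$ is biharmonic if each of its real components is biharmonic. Euclidean spaces and their open subsets carry the flat metric. A smooth map $\varphi:(M,g)\to(N,h)$ between Riemannian manifolds is a *harmonic morphism* (respectively, a *generalized harmonic morphism*) if for every open $W\subseteq N$ and every harmonic function $f:W\to\mathbb{R}$ with $\varphi^{-1}(W)\neq\emptyset$ the function $f\circ\varphi$ is harmonic (respectively, biharmonic) on $\varphi^{-1}(W)$. It is *horizontally weakly conformal* if at every $x\in M$ either $d\varphi_x=0$, or $d\varphi_x:T_xM\to T_{\varphi(x)}N$ is surjective and there is $\Lambda>0$ with $h(d\varphi_x X,d\varphi_x Y)=\Lambda\,g(X,Y)$ for all $X,Y$ in $(\ker d\varphi_x)^{\perp}$. Statement. (a) Let $(M^2,g)$ be a 2-dimensional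 Riemannian manifold. Every generalized harmonic morphism $\varphi:(M^2,g)\to\mathbb{R}^2$ is a harmonic morphism. (b) Let $U\subseteq\mathbb{R}^3$ be open. A map $\varphi:U\to\mathbb{C}$ is a generalized harmonic morphism if and only if it is horizontally weakly conformal and both $\varphi$ and its complex square $\varphi^2$ are biharmonic. -/

import Mathlib

open scoped Manifold ContDiff

noncomputable section

namespace HarmMorph

/-- A smooth Riemannian metric on a smooth manifold `M` modelled (without boundary) on the
finite-dimensional Euclidean space `E`. -/
abbrev Metric (E : Type*) [NormedAddCommGroup E] [InnerProductSpace ℝ E]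
    (M : Type*) [TopologicalSpace M] [ChartedSpace E M] [IsManifold 𝓘(ℝ, E) ∞ M] :=
  Bundle.ContMDiffRiemannianMetric 𝓘(ℝ, E) ∞ E (fun x : M => TangentSpace 𝓘(ℝ, E) x)

/-- The flat metric of a Euclidean space: its inner product on every tangent space. -/
def flat (E : Type*) [NormedAddCommGroup E] [InnerProductSpace ℝ E] : Metric E E :=
  { riemannianMetricVectorSpace E with
    contMDiff := (riemannianMetricVectorSpace E).contMDiff.of_le le_top }

section Laplace

variable {E : Type*} [NormedAddCommGroup E] [InnerProductSpace ℝ E] [FiniteDimensional ℝ E]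
  {M : Type*} [TopologicalSpace M] [ChartedSpace E M] [IsManifold 𝓘(ℝ, E) ∞ M]
  {F : Type*} [NormedAddCommGroup F] [NormedSpace ℝ F]

/-- The Gram matrix `(g_ij)` of the metric in the chart `e` of `M`, with respect to the linear
coordinates of `E` given by an orthonormal basis, as a function of the point `y` of the target
of the chart: `g_ij = g(∂_i, ∂_j)`. -/
def gram (g : Metric E M) (e : OpenPartialHomeomorph M E) (y : E) :
    Matrix (Fin (Module.finrank ℝ E)) (Fin (Module.finrank ℝ E)) ℝ :=
  Matrix.of fun i j =>
    g.inner (e.symm y)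
      (mfderiv 𝓘(ℝ, E) 𝓘(ℝ, E) e.symm y (stdOrthonormalBasis ℝ E i))
      (mfderiv 𝓘(ℝ, E) 𝓘(ℝ, E) e.symm y (stdOrthonormalBasis ℝ E j))

/-- The Laplace–Beltrami operator `Δ f = (det g)^(-1/2) ∂_i ((det g)^(1/2) g^ij ∂_j f)` on
functions `f : M → F` with values in a normed space, computed at the point `x` in the
coordinates of the chart `e` (meaningful for `x` in the domain of `e`). -/
def laplacian (g : Metric E M) (e : OpenPartialHomeomorph M E) (f : M → F) (x : M) : F :=
  (√(gram g e (e x)).det)⁻¹ •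
    ∑ i, ∑ j, fderiv ℝ
      (fun z => (√(gram g e z).det * (gram g e z)⁻¹ i j) •
        fderiv ℝ (f ∘ e.symm) z (stdOrthonormalBasis ℝ E j))
      (e x) (stdOrthonormalBasis ℝ E i)

/-- `f` is a harmonic function on the open set `V` of the Riemannian manifold `(M, g)`: it is
smooth on `V` and `Δ f = 0` there. The Laplacian does not depend on the coordinates, and the
equation is written in each chart of the atlas. -/
def HarmonicOn (g : Metric E M) (f : M → F) (V : Set M) : Prop :=
  ContMDiffOn 𝓘(ℝ, E) 𝓘(ℝ, F) ∞ f V ∧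
    ∀ e ∈ atlas E M, ∀ x ∈ V ∩ e.source, laplacian g e f x = 0

/-- `f` is a biharmonic function on the open set `V` of the Riemannian manifold `(M, g)`: it is
smooth on `V` and `Δ (Δ f) = 0` there. For values in a Euclidean space this says that all the
components of `f` are biharmonic functions, that is, that `f` is a biharmonic map. -/
def BiharmonicOn (g : Metric E M) (f : M → F) (V : Set M) : Prop :=
  ContMDiffOn 𝓘(ℝ, E) 𝓘(ℝ, F) ∞ f V ∧
    ∀ e ∈ atlas E M, ∀ x ∈ V ∩ e.source, laplacian g e (laplacian g e f) x = 0

end Laplace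

section Morphisms

variable {E : Type*} [NormedAddCommGroup E] [InnerProductSpace ℝ E] [FiniteDimensional ℝ E]
  {M : Type*} [TopologicalSpace M] [ChartedSpace E M] [IsManifold 𝓘(ℝ, E) ∞ M]
  {E' : Type*} [NormedAddCommGroup E'] [InnerProductSpace ℝ E'] [FiniteDimensional ℝ E']
  {N : Type*} [TopologicalSpace N] [ChartedSpace E' N] [IsManifold 𝓘(ℝ, E') ∞ N]

/-! In the next three definitions `U` is an open subset of `M`, regarded as a Riemannian manifold
with the restriction of `g`, and `φ` is a smooth map from `U` to `N`; the values of `φ` outside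
`U` play no role. -/

/-- A harmonic morphism `φ : U → N`: it pulls back every real harmonic function on an open subset
of `N` to a harmonic function on the preimage of that subset. -/
def HarmonicMorphismOn (g : Metric E M) (h : Metric E' N) (φ : M → N) (U : Set M) : Prop :=
  ContMDiffOn 𝓘(ℝ, E) 𝓘(ℝ, E') ∞ φ U ∧
    ∀ (W : Set N) (f : N → ℝ), IsOpen W → HarmonicOn h f W →
      HarmonicOn g (f ∘ φ) (U ∩ φ ⁻¹' W)

/-- A generalized harmonic morphism `φ : U → N`: it pulls back every real harmonic function on an
open subset of `N` to a biharmonic function on the preimage of that subset. -/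
def GeneralizedHarmonicMorphismOn (g : Metric E M) (h : Metric E' N) (φ : M → N)
    (U : Set M) : Prop :=
  ContMDiffOn 𝓘(ℝ, E) 𝓘(ℝ, E') ∞ φ U ∧
    ∀ (W : Set N) (f : N → ℝ), IsOpen W → HarmonicOn h f W →
      BiharmonicOn g (f ∘ φ) (U ∩ φ ⁻¹' W)

/-- A horizontally weakly conformal map `φ : U → N`: at every point `x` of `U` either `dφ_x = 0`,
or `dφ_x` maps the horizontal space `(ker dφ_x)^⊥` conformally onto the tangent space of `N` at
`φ x`, with square dilation `Λ`. -/
def HorizontallyWeaklyConformalOn (g : Metric E M) (h : Metric E' N) (φ : M → N)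
    (U : Set M) : Prop :=
  ContMDiffOn 𝓘(ℝ, E) 𝓘(ℝ, E') ∞ φ U ∧
    ∀ x ∈ U, mfderiv 𝓘(ℝ, E) 𝓘(ℝ, E') φ x = 0 ∨
      (Function.Surjective (mfderiv 𝓘(ℝ, E) 𝓘(ℝ, E') φ x) ∧
        ∃ Λ : ℝ, 0 < Λ ∧ ∀ X Y : TangentSpace 𝓘(ℝ, E) x,
          (∀ Z, mfderiv 𝓘(ℝ, E) 𝓘(ℝ, E') φ x Z = 0 → g.inner x X Z = 0) →
          (∀ Z, mfderiv 𝓘(ℝ, E) 𝓘(ℝ, E') φ x Z = 0 → g.inner x Y Z = 0) →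
          h.inner (φ x) (mfderiv 𝓘(ℝ, E) 𝓘(ℝ, E') φ x X) (mfderiv 𝓘(ℝ, E) 𝓘(ℝ, E') φ x Y) =
            Λ * g.inner x X Y)

end Morphisms

end HarmMorph

end

/-! Write `Q` for the complex bilinear square of the gradient of a complex function `u`. For
holomorphic `f` the chain rule reads `Δ(f ∘ u) = f'(u) Δu + f''(u) Q`, and harmonic functions on a
plane are locally real parts of holomorphic ones, so everything reduces to holomorphic functions of
the map.

Testing with `(u - u z)^4` gives `Δ²(u - u z)^4 = 24 Q²` at `z`, so a generalized harmonic morphism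
has `Q = 0` (`SmoothCoeff.gradForm_self_eq_zero`). For maps from a Euclidean space to `ℂ` this is
horizontal weak conformality (`sum_sq_eq_zero_iff`).

Once `Q = 0` identically, `Δ²(f ∘ u) = f'(u) Δ²u + f''(u) R` with `R` independent of `f`
(`SmoothCoeff.divOp_divOp_holomorphic_comp`). Both coefficients vanish as soon as `f = z` and `f =
z^2` give biharmonic functions; this is (b), and it holds in every dimension.

For (a), on a surface `Q = 0` says that at each point `u` is holomorphic or antiholomorphic for the
complex structure of the metric. Either condition on an open set forces `Δu = 0`, and an open-set
argument handles changes of type (`SmoothCoeff.divOp_eq_zero_of_gradForm_self_eq_zero`). With `Q =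
0` and `Δu = 0` the chain rule makes `u` a harmonic morphism. -/

noncomputable section

namespace HarmMorph

open Filter Topology

/-! ### Calculus of divergence-form operators and holomorphic composition. -/

section DivergenceForm

variable {E : Type*} [NormedAddCommGroup E] [NormedSpace ℝ E]
  {F : Type*} [NormedAddCommGroup F] [NormedSpace ℝ F]
  {G : Type*} [NormedAddCommGroup G] [NormedSpace ℝ G]
  {n : ℕ}

/-- The second-order operator `u ↦ ρ ∂_i (A_ij ∂_j u)` in divergence form, where `∂_i` is the
derivative in the direction `v i`. -/
def divOp (ρ : E → ℝ) (A : E → Matrix (Fin n) (Fin n) ℝ) (v : Fin n → E) (u : E → F) (z : E) : F :=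
  ρ z • ∑ i, ∑ j, fderiv ℝ (fun y => A y i j • fderiv ℝ u y (v j)) z (v i)

/-- The bilinear form `ρ A_ij ∂_i u ∂_j w` associated with `divOp ρ A v`. -/
def gradForm (ρ : E → ℝ) (A : E → Matrix (Fin n) (Fin n) ℝ) (v : Fin n → E) (u w : E → ℂ)
    (z : E) : ℂ :=
  ρ z • ∑ i, ∑ j, A z i j • (fderiv ℝ u z (v i) * fderiv ℝ w z (v j))

/-- The coefficients of `divOp ρ A v` are smooth on `O` and `A` is symmetric there. -/
structure SmoothCoeff (ρ : E → ℝ) (A : E → Matrix (Fin n) (Fin n) ℝ) (O : Set E) : Prop where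
  isOpen : IsOpen O
  weight : ContDiffOn ℝ ∞ ρ O
  coeff : ∀ i j, ContDiffOn ℝ ∞ (fun z => A z i j) O
  symm : ∀ z ∈ O, ∀ i j, A z i j = A z j i

variable {ρ : E → ℝ} {A : E → Matrix (Fin n) (Fin n) ℝ} {v : Fin n → E} {O : Set E}

lemma SmoothCoeff.mono (hc : SmoothCoeff ρ A O) {O' : Set E} (hO' : IsOpen O') (h : O' ⊆ O) :
    SmoothCoeff ρ A O' :=
  ⟨hO', hc.weight.mono h, fun i j => (hc.coeff i j).mono h, fun z hz => hc.symm z (h hz)⟩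

lemma contDiffOn_fderiv_apply {u : E → F} (hO : IsOpen O) (hu : ContDiffOn ℝ ∞ u O) (w : E) :
    ContDiffOn ℝ ∞ (fun y => fderiv ℝ u y w) O :=
  (hu.fderiv_of_isOpen hO (by simp)).clm_apply contDiffOn_const

lemma _root_.ContDiffOn.differentiableAt_of_isOpen {u : E → F} (hu : ContDiffOn ℝ ∞ u O) (hO : IsOpen O)
    {z : E} (hz : z ∈ O) : DifferentiableAt ℝ u z :=
  (hu.contDiffAt (hO.mem_nhds hz)).differentiableAt (by simp)

lemma SmoothCoeff.contDiffOn_divOp (hc : SmoothCoeff ρ A O) {u : E → F}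
    (hu : ContDiffOn ℝ ∞ u O) : ContDiffOn ℝ ∞ (divOp ρ A v u) O := by
  refine hc.weight.smul (ContDiffOn.sum fun i _ => ContDiffOn.sum fun j _ => ?_)
  exact contDiffOn_fderiv_apply hc.isOpen
    ((hc.coeff i j).smul (contDiffOn_fderiv_apply hc.isOpen hu _)) _

lemma SmoothCoeff.contDiffOn_gradForm (hc : SmoothCoeff ρ A O) {u w : E → ℂ}
    (hu : ContDiffOn ℝ ∞ u O) (hw : ContDiffOn ℝ ∞ w O) :
    ContDiffOn ℝ ∞ (gradForm ρ A v u w) O := by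
  refine hc.weight.smul (ContDiffOn.sum fun i _ => ContDiffOn.sum fun j _ => ?_)
  exact (hc.coeff i j).smul ((contDiffOn_fderiv_apply hc.isOpen hu _).mul
    (contDiffOn_fderiv_apply hc.isOpen hw _))

lemma divOp_congr {u w : E → F} {z : E} (h : u =ᶠ[𝓝 z] w) :
    divOp ρ A v u z = divOp ρ A v w z := by
  unfold divOp
  congr 1
  refine Finset.sum_congr rfl fun i _ => Finset.sum_congr rfl fun j _ => ?_
  have : (fun y => A y i j • fderiv ℝ u y (v j)) =ᶠ[𝓝 z]
      (fun y => A y i j • fderiv ℝ w y (v j)) := by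
    filter_upwards [h.fderiv (𝕜 := ℝ)] with y hy
    rw [hy]
  rw [this.fderiv_eq]

lemma divOp_congr_of_eqOn {u w : E → F} {S : Set E} (hS : IsOpen S) (h : S.EqOn u w) :
    S.EqOn (divOp ρ A v u) (divOp ρ A v w) := fun _ hz =>
  divOp_congr (h.eventuallyEq_of_mem (hS.mem_nhds hz))

lemma SmoothCoeff.divOp_apply (hc : SmoothCoeff ρ A O) {u : E → F} (hu : ContDiffOn ℝ ∞ u O)
    {z : E} (hz : z ∈ O) :
    divOp ρ A v u z = ρ z • ∑ i, ∑ j, (fderiv ℝ (fun y => A y i j) z (v i) • fderiv ℝ u z (v j) +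
      A z i j • fderiv ℝ (fun y => fderiv ℝ u y (v j)) z (v i)) := by
  unfold divOp
  congr 1
  refine Finset.sum_congr rfl fun i _ => Finset.sum_congr rfl fun j _ => ?_
  have h1 := (hc.coeff i j).differentiableAt_of_isOpen hc.isOpen hz
  have h2 := (contDiffOn_fderiv_apply hc.isOpen hu (v j)).differentiableAt_of_isOpen hc.isOpen hz
  rw [fderiv_fun_smul h1 h2]
  simp [add_comm]

/-- Used with the real part and with multiplication by `-i`, to pass between real test functions and
complex identities. -/
lemma SmoothCoeff.divOp_clm_comp (hc : SmoothCoeff ρ A O) {u : E → F} (hu : ContDiffOn ℝ ∞ u O)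
    (l : F →L[ℝ] G) {z : E} (hz : z ∈ O) :
    divOp ρ A v (fun y => l (u y)) z = l (divOp ρ A v u z) := by
  have hlu : ContDiffOn ℝ ∞ (fun y => l (u y)) O := l.contDiff.comp_contDiffOn hu
  have h1 : ∀ y ∈ O, ∀ w, fderiv ℝ (fun y => l (u y)) y w = l (fderiv ℝ u y w) := fun y hy w => by
    have := (l.hasFDerivAt.comp y (hu.differentiableAt_of_isOpen hc.isOpen hy).hasFDerivAt).fderiv
    rw [Function.comp_def] at this
    rw [this]; rfl
  have h2 : ∀ w w', fderiv ℝ (fun y => fderiv ℝ (fun y => l (u y)) y w) z w' =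
      l (fderiv ℝ (fun y => fderiv ℝ u y w) z w') := fun w w' => by
    have he : (fun y => fderiv ℝ (fun y => l (u y)) y w) =ᶠ[𝓝 z]
        fun y => l (fderiv ℝ u y w) := by
      filter_upwards [hc.isOpen.mem_nhds hz] with y hy using h1 y hy w
    have := (l.hasFDerivAt.comp z ((contDiffOn_fderiv_apply hc.isOpen hu
      w).differentiableAt_of_isOpen hc.isOpen hz).hasFDerivAt).fderiv
    rw [Function.comp_def] at this
    rw [he.fderiv_eq, this]; rfl
  rw [hc.divOp_apply hlu hz, hc.divOp_apply hu hz]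
  simp only [h1 z hz, h2, map_smul, map_sum, map_add]

lemma SmoothCoeff.divOp_add (hc : SmoothCoeff ρ A O) {u w : E → F} (hu : ContDiffOn ℝ ∞ u O)
    (hw : ContDiffOn ℝ ∞ w O) {z : E} (hz : z ∈ O) :
    divOp ρ A v (fun y => u y + w y) z = divOp ρ A v u z + divOp ρ A v w z := by
  have hO := hc.isOpen
  have key : ∀ {u w : E → F}, ContDiffOn ℝ ∞ u O → ContDiffOn ℝ ∞ w O → ∀ y ∈ O, ∀ a,
      fderiv ℝ (fun y => u y + w y) y a = fderiv ℝ u y a + fderiv ℝ w y a := by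
    intro u w hu hw y hy a
    rw [fderiv_fun_add (hu.differentiableAt_of_isOpen hO hy) (hw.differentiableAt_of_isOpen hO hy)]
    simp
  have h2 : ∀ a b, fderiv ℝ (fun y => fderiv ℝ (fun y => u y + w y) y a) z b =
      fderiv ℝ (fun y => fderiv ℝ u y a) z b + fderiv ℝ (fun y => fderiv ℝ w y a) z b := by
    intro a b
    have he : (fun y => fderiv ℝ (fun y => u y + w y) y a) =ᶠ[𝓝 z]
        fun y => fderiv ℝ u y a + fderiv ℝ w y a := by
      filter_upwards [hO.mem_nhds hz] with y hy using key hu hw y hy a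
    rw [he.fderiv_eq,
      key (contDiffOn_fderiv_apply hO hu a) (contDiffOn_fderiv_apply hO hw a) z hz]
  rw [hc.divOp_apply (hu.add hw) hz, hc.divOp_apply hu hz, hc.divOp_apply hw hz, ← smul_add]
  simp only [key hu hw z hz, h2, ← Finset.sum_add_distrib]
  congr 1
  refine Finset.sum_congr rfl fun i _ => Finset.sum_congr rfl fun j _ => ?_
  simp only [smul_add]
  abel

lemma SmoothCoeff.divOp_mul (hc : SmoothCoeff ρ A O) {u w : E → ℂ} (hu : ContDiffOn ℝ ∞ u O)
    (hw : ContDiffOn ℝ ∞ w O) {z : E} (hz : z ∈ O) :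
    divOp ρ A v (fun y => u y * w y) z =
      u z * divOp ρ A v w z + divOp ρ A v u z * w z + 2 * gradForm ρ A v u w z := by
  have hO := hc.isOpen
  have key : ∀ {u w : E → ℂ}, ContDiffOn ℝ ∞ u O → ContDiffOn ℝ ∞ w O → ∀ y ∈ O, ∀ a,
      fderiv ℝ (fun y => u y * w y) y a = u y * fderiv ℝ w y a + fderiv ℝ u y a * w y := by
    intro u w hu hw y hy a
    rw [fderiv_fun_mul (hu.differentiableAt_of_isOpen hO hy) (hw.differentiableAt_of_isOpen hO hy)]
    simp [mul_comm]
  have h2 : ∀ a b, fderiv ℝ (fun y => fderiv ℝ (fun y => u y * w y) y a) z b =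
      (u z * fderiv ℝ (fun y => fderiv ℝ w y a) z b + fderiv ℝ u z b * fderiv ℝ w z a) +
      (fderiv ℝ u z a * fderiv ℝ w z b + fderiv ℝ (fun y => fderiv ℝ u y a) z b * w z) := by
    intro a b
    have du := contDiffOn_fderiv_apply hO hu a
    have dw := contDiffOn_fderiv_apply hO hw a
    have he : (fun y => fderiv ℝ (fun y => u y * w y) y a) =ᶠ[𝓝 z]
        fun y => u y * fderiv ℝ w y a + fderiv ℝ u y a * w y := by
      filter_upwards [hO.mem_nhds hz] with y hy using key hu hw y hy a
    rw [he.fderiv_eq, fderiv_fun_add ((hu.mul dw).differentiableAt_of_isOpen hO hz)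
      ((du.mul hw).differentiableAt_of_isOpen hO hz), add_apply,
      key hu dw z hz, key du hw z hz]
  -- The two cross terms of the Leibniz rule coincide because `A` is symmetric.
  have hsym : ∑ i, ∑ j, A z i j • (fderiv ℝ u z (v j) * fderiv ℝ w z (v i)) =
      ∑ i, ∑ j, A z i j • (fderiv ℝ u z (v i) * fderiv ℝ w z (v j)) := by
    rw [Finset.sum_comm]
    refine Finset.sum_congr rfl fun i _ => Finset.sum_congr rfl fun j _ => ?_
    rw [hc.symm z hz]
  rw [hc.divOp_apply (hu.mul hw) hz, hc.divOp_apply hu hz, hc.divOp_apply hw hz, gradForm]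
  simp only [key hu hw z hz, h2]
  have : ∀ a b c d : ℂ, ∀ r : ℝ, a = b + c + 2 * d → r • a = r • b + r • c + 2 * (r • d) := by
    rintro a b c d r rfl
    simp only [Complex.real_smul]; ring
  rw [mul_smul_comm, smul_mul_assoc]
  refine this _ _ _ _ _ ?_
  rw [two_mul]
  nth_rw 1 [← hsym]
  simp only [Finset.mul_sum, Finset.sum_mul, ← Finset.sum_add_distrib]
  refine Finset.sum_congr rfl fun i _ => Finset.sum_congr rfl fun j _ => ?_
  simp only [Complex.real_smul]
  ring

lemma contDiffOn_holomorphic_comp {u : E → ℂ} (hu : ContDiffOn ℝ ∞ u O)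
    {S : Set ℂ} (hS : IsOpen S) (hOS : Set.MapsTo u O S) {f : ℂ → ℂ} (hf : DifferentiableOn ℂ f S) :
    ContDiffOn ℝ ∞ (fun y => f (u y)) O := by
  have h : ContDiffOn ℝ ∞ f S := (hf.contDiffOn hS).restrict_scalars ℝ
  exact h.comp hu hOS

lemma fderiv_holomorphic_comp (hO : IsOpen O) {u : E → ℂ} (hu : ContDiffOn ℝ ∞ u O)
    {S : Set ℂ} (hS : IsOpen S) (hOS : Set.MapsTo u O S) {f : ℂ → ℂ} (hf : DifferentiableOn ℂ f S)
    {y : E} (hy : y ∈ O) (a : E) :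
    fderiv ℝ (fun y => f (u y)) y a = deriv f (u y) * fderiv ℝ u y a := by
  have h1 := (hf.differentiableAt (hS.mem_nhds (hOS hy))).hasDerivAt
  have h2 := (hu.differentiableAt_of_isOpen hO hy).hasFDerivAt
  have := (h1.complexToReal_fderiv.comp y h2).fderiv
  rw [Function.comp_def] at this
  rw [this]
  simp

/-- The derivative of `f` is complex linear, so no conjugate of `u` enters and the second-order term
is the bilinear, not the Hermitian, square of the gradient. -/
lemma SmoothCoeff.divOp_holomorphic_comp (hc : SmoothCoeff ρ A O) {u : E → ℂ}
    (hu : ContDiffOn ℝ ∞ u O) {S : Set ℂ} (hS : IsOpen S) (hOS : Set.MapsTo u O S) {f : ℂ → ℂ}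
    (hf : DifferentiableOn ℂ f S) {z : E} (hz : z ∈ O) :
    divOp ρ A v (fun y => f (u y)) z =
      deriv f (u z) * divOp ρ A v u z + deriv (deriv f) (u z) * gradForm ρ A v u u z := by
  have hO := hc.isOpen
  have hf' := hf.deriv hS
  have hfu' := contDiffOn_holomorphic_comp hu hS hOS hf'
  have h2 : ∀ a b, fderiv ℝ (fun y => fderiv ℝ (fun y => f (u y)) y a) z b =
      deriv f (u z) * fderiv ℝ (fun y => fderiv ℝ u y a) z b +
        deriv (deriv f) (u z) * (fderiv ℝ u z b * fderiv ℝ u z a) := by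
    intro a b
    have he : (fun y => fderiv ℝ (fun y => f (u y)) y a) =ᶠ[𝓝 z]
        fun y => deriv f (u y) * fderiv ℝ u y a := by
      filter_upwards [hO.mem_nhds hz] with y hy
        using fderiv_holomorphic_comp hO hu hS hOS hf hy a
    rw [he.fderiv_eq, fderiv_fun_mul (hfu'.differentiableAt_of_isOpen hO hz)
      ((contDiffOn_fderiv_apply hO hu a).differentiableAt_of_isOpen hO hz)]
    simp only [add_apply, smul_apply, smul_eq_mul,
      fderiv_holomorphic_comp hO hu hS hOS hf' hz]
    ring
  rw [hc.divOp_apply (contDiffOn_holomorphic_comp hu hS hOS hf) hz, hc.divOp_apply hu hz, gradForm]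
  simp only [fderiv_holomorphic_comp hO hu hS hOS hf hz, h2]
  rw [mul_smul_comm, mul_smul_comm, ← smul_add]
  congr 1
  simp only [Finset.mul_sum, ← Finset.sum_add_distrib]
  refine Finset.sum_congr rfl fun i _ => Finset.sum_congr rfl fun j _ => ?_
  simp only [Complex.real_smul]
  ring

lemma gradForm_holomorphic_comp_left (hO : IsOpen O) {u : E → ℂ} (hu : ContDiffOn ℝ ∞ u O)
    {S : Set ℂ} (hS : IsOpen S) (hOS : Set.MapsTo u O S) {f : ℂ → ℂ} (hf : DifferentiableOn ℂ f S)
    (w : E → ℂ) {z : E} (hz : z ∈ O) :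
    gradForm ρ A v (fun y => f (u y)) w z = deriv f (u z) * gradForm ρ A v u w z := by
  simp only [gradForm, fderiv_holomorphic_comp hO hu hS hOS hf hz]
  rw [mul_smul_comm]
  congr 1
  simp only [Finset.mul_sum]
  refine Finset.sum_congr rfl fun i _ => Finset.sum_congr rfl fun j _ => ?_
  simp only [Complex.real_smul]
  ring

/-- Third and fourth derivatives of `f` would enter only through `Q` and its derivatives, which
vanish on the open set `O`. The remaining bracket depends on `u` alone. -/
lemma SmoothCoeff.divOp_divOp_holomorphic_comp (hc : SmoothCoeff ρ A O) {u : E → ℂ}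
    (hu : ContDiffOn ℝ ∞ u O) (hQ : ∀ z ∈ O, gradForm ρ A v u u z = 0) {S : Set ℂ}
    (hS : IsOpen S) (hOS : Set.MapsTo u O S) {f : ℂ → ℂ} (hf : DifferentiableOn ℂ f S)
    {z : E} (hz : z ∈ O) :
    divOp ρ A v (divOp ρ A v (fun y => f (u y))) z =
      deriv f (u z) * divOp ρ A v (divOp ρ A v u) z + deriv (deriv f) (u z) *
        (divOp ρ A v u z ^ 2 + 2 * gradForm ρ A v u (divOp ρ A v u) z) := by
  have hτ := hc.contDiffOn_divOp (v := v) hu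
  have he : O.EqOn (divOp ρ A v (fun y => f (u y))) (fun y => deriv f (u y) * divOp ρ A v u y) :=
    fun y hy => by rw [hc.divOp_holomorphic_comp hu hS hOS hf hy, hQ y hy, mul_zero, add_zero]
  rw [divOp_congr_of_eqOn hc.isOpen he hz,
    hc.divOp_mul (contDiffOn_holomorphic_comp hu hS hOS (hf.deriv hS)) hτ hz,
    hc.divOp_holomorphic_comp hu hS hOS (hf.deriv hS) hz,
    gradForm_holomorphic_comp_left hc.isOpen hu hS hOS (hf.deriv hS) _ hz, hQ z hz]
  ring

/-- If a map with isotropic gradient and its square are biharmonic, so is every holomorphic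
function of the map. -/
lemma SmoothCoeff.divOp_divOp_holomorphic_comp_eq_zero (hc : SmoothCoeff ρ A O) {u : E → ℂ}
    (hu : ContDiffOn ℝ ∞ u O) (hQ : ∀ z ∈ O, gradForm ρ A v u u z = 0)
    {S : Set ℂ} (hS : IsOpen S) (hOS : Set.MapsTo u O S) {f : ℂ → ℂ} (hf : DifferentiableOn ℂ f S)
    {z : E} (hz : z ∈ O) (h1 : divOp ρ A v (divOp ρ A v u) z = 0)
    (h2 : divOp ρ A v (divOp ρ A v (fun y => u y ^ 2)) z = 0) :
    divOp ρ A v (divOp ρ A v (fun y => f (u y))) z = 0 := by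
  rw [hc.divOp_divOp_holomorphic_comp hu hQ isOpen_univ (Set.mapsTo_univ _ _)
    (f := fun z => z ^ 2) (by fun_prop) hz, h1] at h2
  have hd : deriv (fun z : ℂ => z ^ 2) = fun z => 2 * z := by ext; simp
  rw [hd, deriv_const_mul_field, deriv_id''] at h2
  rw [hc.divOp_divOp_holomorphic_comp hu hQ hS hOS hf hz, h1]
  -- For the square the second derivative is `2`, so `h2` says that twice the bracket vanishes.
  linear_combination deriv (deriv f) (u z) / 2 * h2

/-- If the fourth power of `u - u z` is biharmonic at `z`, the gradient of `u` is isotropic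
at `z`. -/
lemma SmoothCoeff.gradForm_self_eq_zero (hc : SmoothCoeff ρ A O) {u : E → ℂ}
    (hu : ContDiffOn ℝ ∞ u O) {z : E} (hz : z ∈ O)
    (h4 : divOp ρ A v (divOp ρ A v (fun y => (u y - u z) ^ 4)) z = 0) :
    gradForm ρ A v u u z = 0 := by
  have hτ := hc.contDiffOn_divOp (v := v) hu
  have hg := hc.contDiffOn_gradForm (v := v) hu hu
  have hd : ∀ m : ℕ, deriv (fun y : ℂ => (y - u z) ^ m) =
      fun y => (m : ℂ) * (y - u z) ^ (m - 1) := fun m => by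
    ext y
    simp
  have hd' : ∀ (m : ℕ) (c : ℂ), deriv (fun y : ℂ => c * (y - u z) ^ m) =
      fun y => c * (m * (y - u z) ^ (m - 1)) := fun m c => by
    ext y
    rw [deriv_const_mul_field, hd]
  have h0 : ∀ (m : ℕ), Differentiable ℂ (fun y : ℂ => (y - u z) ^ m) := fun m => by fun_prop
  have h0' : ∀ (m : ℕ) (c : ℂ), Differentiable ℂ (fun y : ℂ => c * (y - u z) ^ m) :=
    fun m c => by fun_prop
  have hU := Set.mapsTo_univ u O
  have he : O.EqOn (divOp ρ A v (fun y => (u y - u z) ^ 4)) (fun y =>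
      (4 * (u y - u z) ^ 3) * divOp ρ A v u y + (12 * (u y - u z) ^ 2) * gradForm ρ A v u u y) := by
    intro y hy
    rw [hc.divOp_holomorphic_comp hu isOpen_univ hU (h0 4).differentiableOn hy, hd, hd']
    push_cast
    ring
  have s3 := contDiffOn_holomorphic_comp hu isOpen_univ hU (h0' 3 4).differentiableOn
  have s2 := contDiffOn_holomorphic_comp hu isOpen_univ hU (h0' 2 12).differentiableOn
  rw [divOp_congr_of_eqOn hc.isOpen he hz, hc.divOp_add (s3.mul hτ) (s2.mul hg) hz,
    hc.divOp_mul s3 hτ hz, hc.divOp_mul s2 hg hz,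
    hc.divOp_holomorphic_comp hu isOpen_univ hU (h0' 3 4).differentiableOn hz,
    hc.divOp_holomorphic_comp hu isOpen_univ hU (h0' 2 12).differentiableOn hz,
    gradForm_holomorphic_comp_left hc.isOpen hu isOpen_univ hU (h0' 3 4).differentiableOn _ hz,
    gradForm_holomorphic_comp_left hc.isOpen hu isOpen_univ hU (h0' 2 12).differentiableOn _ hz] at h4
  -- At `z` every term with a factor `u - u z` drops out. Only the Laplacian of `12 (u - u z)^2`,
  -- equal to `24 Q` there, times `Q` survives.
  simp only [hd', ← mul_assoc] at h4
  simpa using h4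

end DivergenceForm

/-! ### Isotropic gradients in two variables. -/

section Plane

variable {E : Type*} [NormedAddCommGroup E] [NormedSpace ℝ E]
  {ρ : E → ℝ} {A : E → Matrix (Fin 2) (Fin 2) ℝ} {v : Fin 2 → E} {O : Set E}

/-- The flux `A ∇u` is a constant multiple of the gradient rotated by a right angle, whose
divergence vanishes since second derivatives commute. -/
lemma SmoothCoeff.divOp_eq_zero_of_rotation (hc : SmoothCoeff ρ A O) {u : E → ℂ}
    (hu : ContDiffOn ℝ ∞ u O) (s : ℂ)
    (h0 : ∀ z ∈ O, A z 0 0 * fderiv ℝ u z (v 0) + A z 0 1 * fderiv ℝ u z (v 1) =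
      s * fderiv ℝ u z (v 1))
    (h1 : ∀ z ∈ O, A z 1 0 * fderiv ℝ u z (v 0) + A z 1 1 * fderiv ℝ u z (v 1) =
      -s * fderiv ℝ u z (v 0)) {z : E} (hz : z ∈ O) : divOp ρ A v u z = 0 := by
  have hO := hc.isOpen
  have hp : ∀ i, DifferentiableAt ℝ (fun y => fderiv ℝ u y (v i)) z := fun i =>
    (contDiffOn_fderiv_apply hO hu (v i)).differentiableAt_of_isOpen hO hz
  have hAp : ∀ i j, DifferentiableAt ℝ (fun y => A y i j • fderiv ℝ u y (v j)) z := fun i j =>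
    ((hc.coeff i j).differentiableAt_of_isOpen hO hz).smul (hp j)
  have key : ∀ i k (c : ℂ), (∀ y ∈ O, A y i 0 * fderiv ℝ u y (v 0) +
      A y i 1 * fderiv ℝ u y (v 1) = c * fderiv ℝ u y (v k)) →
      fderiv ℝ (fun y => A y i 0 • fderiv ℝ u y (v 0)) z (v i) +
        fderiv ℝ (fun y => A y i 1 • fderiv ℝ u y (v 1)) z (v i) =
      c * fderiv ℝ (fun y => fderiv ℝ u y (v k)) z (v i) := by
    intro i k c h
    have he : (fun y => A y i 0 • fderiv ℝ u y (v 0) + A y i 1 • fderiv ℝ u y (v 1)) =ᶠ[𝓝 z]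
        fun y => c * fderiv ℝ u y (v k) := by
      filter_upwards [hO.mem_nhds hz] with y hy
      simpa only [Complex.real_smul] using h y hy
    rw [← add_apply, ← fderiv_fun_add (hAp i 0) (hAp i 1), he.fderiv_eq,
      fderiv_const_mul (hp k)]
    simp
  have hsymm : fderiv ℝ (fun y => fderiv ℝ u y (v 1)) z (v 0) =
      fderiv ℝ (fun y => fderiv ℝ u y (v 0)) z (v 1) := by
    have hat := hu.contDiffAt (hO.mem_nhds hz)
    have hd : DifferentiableAt ℝ (fderiv ℝ u) z :=
      (hat.fderiv_right (m := 1) (by norm_cast)).differentiableAt (by simp)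
    have hs := (hat.isSymmSndFDerivAt
      (by rw [minSmoothness_of_isRCLikeNormedField]; exact WithTop.coe_le_coe.2 le_top)) (v 0) (v 1)
    have hw : ∀ w, fderiv ℝ (fun y => fderiv ℝ u y w) z = (fderiv ℝ (fderiv ℝ u) z).flip w :=
      fun w => by simp [fderiv_clm_apply hd (differentiableAt_const w)]
    simpa [hw] using hs
  simp only [divOp, Fin.sum_univ_two]
  rw [key 0 1 s h0, key 1 0 (-s) h1, hsymm]
  simp

/-- On a surface, a complex function with isotropic gradient is harmonic. -/
lemma SmoothCoeff.divOp_eq_zero_of_gradForm_self_eq_zero (hc : SmoothCoeff ρ A O)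
    (hρ : ∀ z ∈ O, ρ z ≠ 0) (hdet : ∀ z ∈ O, (A z).det = 1) {u : E → ℂ}
    (hu : ContDiffOn ℝ ∞ u O) (hQ : ∀ z ∈ O, gradForm ρ A v u u z = 0) {z : E} (hz : z ∈ O) :
    divOp ρ A v u z = 0 := by
  have hO := hc.isOpen
  set D : Fin 2 → Fin 2 → E → ℂ → ℂ := fun i k y c => A y i 0 * fderiv ℝ u y (v 0) +
      A y i 1 * fderiv ℝ u y (v 1) - c * fderiv ℝ u y (v k) with hD
  have hDc : ∀ i k c, ContinuousOn (fun y => D i k y c) O := by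
    intro i k c
    have hA : ∀ i j, ContinuousOn (fun y => (A y i j : ℂ)) O := fun i j =>
      Complex.continuous_ofReal.comp_continuousOn (hc.coeff i j).continuousOn
    have hp : ∀ j, ContinuousOn (fun y => fderiv ℝ u y (v j)) O := fun j =>
      (contDiffOn_fderiv_apply hO hu (v j)).continuousOn
    exact (((hA i 0).mul (hp 0)).add ((hA i 1).mul (hp 1))).sub (continuousOn_const.mul (hp k))
  have hcase : ∀ y ∈ O, (D 0 1 y Complex.I = 0 ∧ D 1 0 y (-Complex.I) = 0) ∨
      (D 0 1 y (-Complex.I) = 0 ∧ D 1 0 y Complex.I = 0) := by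
    intro y hy
    have h1 := hQ y hy
    have h2 := hdet y hy
    have h3 := hc.symm y hy 1 0
    rw [gradForm, smul_eq_zero_iff_right (hρ y hy)] at h1
    simp only [Fin.sum_univ_two, Complex.real_smul, h3] at h1
    rw [Matrix.det_fin_two, h3] at h2
    have ha : A y 0 0 ≠ 0 := fun h => by rw [h] at h2; nlinarith [sq_nonneg (A y 0 1)]
    simp only [hD, h3]
    have haC : (A y 0 0 : ℂ) ≠ 0 := by exact_mod_cast ha
    have h2C : (A y 0 0 : ℂ) * A y 1 1 - A y 0 1 * A y 0 1 = 1 := by exact_mod_cast h2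
    generalize (A y 0 0 : ℂ) = a at *
    generalize (A y 0 1 : ℂ) = b at *
    generalize (A y 1 1 : ℂ) = d at *
    generalize fderiv ℝ u y (v 0) = p at *
    generalize fderiv ℝ u y (v 1) = q at *
    have hI := Complex.I_mul_I
    -- Since `ad - b² = 1`, multiplying `ap² + 2bpq + dq²` by `a` gives `(ap + bq)² + q²`, which
    -- splits over `ℂ`. Each factor yields the Cauchy-Riemann equations for one orientation.
    have hfac : (a * p + b * q - Complex.I * q) * (a * p + b * q - -Complex.I * q) = 0 := by
      linear_combination a * h1 - q ^ 2 * h2C - q ^ 2 * hI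
    rcases mul_eq_zero.1 hfac with h | h
    · refine Or.inl ⟨h, mul_left_cancel₀ haC ?_⟩
      linear_combination (b + Complex.I) * h + q * h2C + q * hI
    · refine Or.inr ⟨h, mul_left_cancel₀ haC ?_⟩
      linear_combination (b - Complex.I) * h + q * h2C + q * hI
  have hon : ∀ O' ⊆ O, IsOpen O' → ∀ c, (∀ y ∈ O', D 0 1 y c = 0 ∧ D 1 0 y (-c) = 0) →
      ∀ y ∈ O', divOp ρ A v u y = 0 := by
    intro O' hO'O hO' c h y hy
    exact (hc.mono hO' hO'O).divOp_eq_zero_of_rotation (hu.mono hO'O) c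
      (fun y hy => sub_eq_zero.1 (h y hy).1) (fun y hy => sub_eq_zero.1 (h y hy).2) hy
  -- The sign of the rotation may vary from point to point. On the open set where `Δu ≠ 0`, failure
  -- of one sign persists nearby and forces the other sign on an open set, hence `Δu = 0` there. So
  -- the equations with `+i` hold on all of that set, which again gives `Δu = 0`.
  by_contra hne
  have hopen : ∀ (f : E → ℂ), ContinuousOn f O → ∀ O' ⊆ O, IsOpen O' →
      IsOpen (O' ∩ {y | f y ≠ 0}) := fun f hf O' hO'O hO' =>
    (hf.mono hO'O).isOpen_inter_preimage hO' isOpen_compl_singleton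
  set O₁ := O ∩ {y | divOp ρ A v u y ≠ 0} with hO₁
  have hO₁o : IsOpen O₁ := hopen _ (hc.contDiffOn_divOp hu).continuousOn O subset_rfl hO
  have hO₁s : O₁ ⊆ O := Set.inter_subset_left
  have hvan : ∀ i k c c', (∀ y ∈ O, D i k y c ≠ 0 → D 0 1 y c' = 0 ∧ D 1 0 y (-c') = 0) →
      ∀ y ∈ O₁, D i k y c = 0 := by
    intro i k c c' h y hy
    by_contra hy0
    refine hy.2 (hon (O₁ ∩ {y | D i k y c ≠ 0}) (Set.inter_subset_left.trans hO₁s)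
      (hopen _ (hDc i k c) O₁ hO₁s hO₁o) c' (fun y hy => h y (hO₁s hy.1) hy.2) y ⟨hy, hy0⟩)
  have ha := hvan 0 1 Complex.I (-Complex.I) fun y hy h => by
    rw [neg_neg]
    exact (hcase y hy).resolve_left fun h' => h h'.1
  have hb := hvan 1 0 (-Complex.I) (-Complex.I) fun y hy h => by
    rw [neg_neg]
    exact (hcase y hy).resolve_left fun h' => h h'.2
  exact hne (hon O₁ hO₁s hO₁o Complex.I (fun y hy => ⟨ha y hy, hb y hy⟩) z ⟨hz, hne⟩)

end Plane

/-! ### Coefficients built from a Gram matrix. -/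

section Gram

variable {E : Type*} [NormedAddCommGroup E] [NormedSpace ℝ E] {n : ℕ} {O : Set E}

lemma contDiffOn_det {G : E → Matrix (Fin n) (Fin n) ℝ}
    (hG : ∀ i j, ContDiffOn ℝ ∞ (fun z => G z i j) O) : ContDiffOn ℝ ∞ (fun z => (G z).det) O := by
  simp only [Matrix.det_apply']
  exact ContDiffOn.sum fun σ _ => contDiffOn_const.mul (contDiffOn_prod fun i _ => hG _ _)

lemma contDiffOn_inv_apply {G : E → Matrix (Fin n) (Fin n) ℝ}
    (hG : ∀ i j, ContDiffOn ℝ ∞ (fun z => G z i j) O) (h0 : ∀ z ∈ O, (G z).det ≠ 0) (i j : Fin n) :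
    ContDiffOn ℝ ∞ (fun z => (G z)⁻¹ i j) O := by
  simp only [Matrix.inv_def, Matrix.smul_apply, Ring.inverse_eq_inv', smul_eq_mul,
    Matrix.adjugate_apply]
  refine ((contDiffOn_det hG).inv h0).mul (contDiffOn_det fun k l => ?_)
  simp only [Matrix.updateRow_apply]
  split_ifs
  · exact contDiffOn_const
  · exact hG k l

/-- The coefficients of the Laplace–Beltrami operator are smooth. -/
lemma smoothCoeff_of_posDef (hO : IsOpen O) {G : E → Matrix (Fin n) (Fin n) ℝ}
    (hG : ∀ i j, ContDiffOn ℝ ∞ (fun z => G z i j) O) (hpos : ∀ z ∈ O, (G z).PosDef) :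
    SmoothCoeff (fun z => (√(G z).det)⁻¹) (fun z => √(G z).det • (G z)⁻¹) O where
  isOpen := hO
  weight := ((contDiffOn_det hG).sqrt fun z hz => (hpos z hz).det_pos.ne').inv
    fun z hz => (Real.sqrt_pos.2 (hpos z hz).det_pos).ne'
  coeff i j := ((contDiffOn_det hG).sqrt fun z hz => (hpos z hz).det_pos.ne').mul
    (contDiffOn_inv_apply hG (fun z hz => (hpos z hz).det_pos.ne') i j)
  symm z hz i j := by
    have h := (hpos z hz).isHermitian.inv
    simp only [Matrix.smul_apply]
    rw [← h.apply i j]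
    simp

/-- Special to dimension two: the scalar `√det G` is squared by the determinant and cancels that of
the inverse. This reflects conformal invariance. -/
lemma det_sqrt_det_smul_inv {G : Matrix (Fin 2) (Fin 2) ℝ} (hG : 0 < G.det) :
    (√G.det • G⁻¹).det = 1 := by
  rw [Matrix.det_smul, Matrix.det_nonsing_inv, Fintype.card_fin, Real.sq_sqrt hG.le,
    Ring.inverse_eq_inv', mul_inv_cancel₀ hG.ne']

end Gram

/-! ### The Laplace–Beltrami operator in a chart. -/

section Chart

variable {E : Type*} [NormedAddCommGroup E] [InnerProductSpace ℝ E] [FiniteDimensional ℝ E]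
  {M : Type*} [TopologicalSpace M] [ChartedSpace E M] [IsManifold 𝓘(ℝ, E) ∞ M]
  {F : Type*} [NormedAddCommGroup F] [NormedSpace ℝ F]

lemma contDiffOn_gram (g : Metric E M) {e : OpenPartialHomeomorph M E} (he : e ∈ atlas E M)
    (i j : Fin (Module.finrank ℝ E)) : ContDiffOn ℝ ∞ (fun y => gram g e y i j) e.target := by
  have hs : ContMDiffOn 𝓘(ℝ, E) 𝓘(ℝ, E) ∞ e.symm e.target :=
    contMDiffOn_symm_of_mem_maximalAtlas (IsManifold.subset_maximalAtlas he)
  have hv : ∀ w : E, ContMDiffOn 𝓘(ℝ, E) (𝓘(ℝ, E).prod 𝓘(ℝ, E)) ∞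
      (fun y => Bundle.TotalSpace.mk' E (E := fun x : M => TangentSpace 𝓘(ℝ, E) x) (e.symm y)
        (mfderiv 𝓘(ℝ, E) 𝓘(ℝ, E) e.symm y w)) e.target := by
    intro w
    -- A coordinate vector field is the tangent map of `e.symm` applied to a constant field, hence
    -- smooth.
    have h1 := hs.contMDiffOn_tangentMapWithin (m := ∞) (by simp) e.open_target.uniqueMDiffOn
    have h2 : ContMDiff 𝓘(ℝ, E) (𝓘(ℝ, E).prod 𝓘(ℝ, E)) ∞
        (fun y : E => (⟨y, w⟩ : TangentBundle 𝓘(ℝ, E) E)) := by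
      exact contMDiff_vectorSpace_iff_contDiff.2 contDiff_const
    refine (h1.comp h2.contMDiffOn fun y hy => hy).congr fun y hy => ?_
    simp [tangentMapWithin, mfderivWithin_of_isOpen e.open_target hy]
  have := ContMDiffOn.clm_bundle_apply₂ (F₁ := E) (F₂ := E) (F₃ := ℝ)
    (E₁ := fun x : M => TangentSpace 𝓘(ℝ, E) x) (E₂ := fun x : M => TangentSpace 𝓘(ℝ, E) x)
    (E₃ := Bundle.Trivial M ℝ)
    (g.contMDiff.comp_contMDiffOn hs) (hv (stdOrthonormalBasis ℝ E i))
    (hv (stdOrthonormalBasis ℝ E j))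
  rw [← contMDiffOn_iff_contDiffOn]
  intro y hy
  exact (Bundle.contMDiffWithinAt_totalSpace.1 (this y hy)).2

/-- Stated on `E` alone; each tangent space of `M` is `E` by definition, so the metric and the chart
derivative fit in directly. -/
lemma posDef_of_bilin (D : E →L[ℝ] E) (hD : Function.Injective D) (B : E →L[ℝ] E →L[ℝ] ℝ)
    (hB : ∀ x y, B x y = B y x) (hpos : ∀ x, x ≠ 0 → 0 < B x x) :
    (Matrix.of fun i j =>
      B (D (stdOrthonormalBasis ℝ E i)) (D (stdOrthonormalBasis ℝ E j))).PosDef := by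
  refine Matrix.PosDef.of_dotProduct_mulVec_pos (Matrix.IsHermitian.ext fun i j => ?_)
    fun c hc => ?_
  · simpa using hB _ _
  · set w : E := ∑ i, c i • stdOrthonormalBasis ℝ E i with hw
    have hw0 : w ≠ 0 := fun h => hc <| by
      ext i
      exact Fintype.linearIndependent_iff.1
        (stdOrthonormalBasis ℝ E).orthonormal.linearIndependent c h i
    refine (hpos (D w) fun h => hw0 (hD (by rw [h, map_zero]))).trans_eq ?_
    simp only [hw, map_sum, map_smul, sum_apply, smul_apply, dotProduct,
      Matrix.mulVec, Matrix.of_apply, Pi.star_apply, star_trivial, smul_eq_mul, Finset.mul_sum]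
    refine Finset.sum_congr rfl fun i _ => Finset.sum_congr rfl fun j _ => ?_
    rw [hB]
    ring

lemma posDef_gram (g : Metric E M) {e : OpenPartialHomeomorph M E} (he : e ∈ atlas E M)
    {y : E} (hy : y ∈ e.target) : (gram g e y).PosDef := by
  have hinj : Function.Injective (mfderiv 𝓘(ℝ, E) 𝓘(ℝ, E) e.symm y) :=
    (mdifferentiable_of_mem_atlas he).symm.mfderiv_injective hy
  exact posDef_of_bilin (E := E) (show E →L[ℝ] E from mfderiv 𝓘(ℝ, E) 𝓘(ℝ, E) e.symm y) hinj
    (show E →L[ℝ] E →L[ℝ] ℝ from g.inner (e.symm y)) (g.symm (e.symm y)) (g.pos (e.symm y))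

lemma smoothCoeff_gram (g : Metric E M) {e : OpenPartialHomeomorph M E} (he : e ∈ atlas E M) :
    SmoothCoeff (fun z => (√(gram g e z).det)⁻¹) (fun z => √(gram g e z).det • (gram g e z)⁻¹)
      e.target :=
  smoothCoeff_of_posDef e.open_target (contDiffOn_gram g he) fun _ hy => posDef_gram g he hy

/-- The Laplace–Beltrami operator as an operator on functions on the target of the chart `e`. -/
abbrev chartLap (g : Metric E M) (e : OpenPartialHomeomorph M E) (u : E → F) : E → F :=
  divOp (fun z => (√(gram g e z).det)⁻¹) (fun z => √(gram g e z).det • (gram g e z)⁻¹)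
    (stdOrthonormalBasis ℝ E) u

/-- The complex bilinear square of the gradient, in the chart `e`. -/
abbrev chartGradForm (g : Metric E M) (e : OpenPartialHomeomorph M E) (u w : E → ℂ) : E → ℂ :=
  gradForm (fun z => (√(gram g e z).det)⁻¹) (fun z => √(gram g e z).det • (gram g e z)⁻¹)
    (stdOrthonormalBasis ℝ E) u w

lemma laplacian_eq_chartLap (g : Metric E M) (e : OpenPartialHomeomorph M E) (f : M → F) (x : M) :
    laplacian g e f x = chartLap g e (f ∘ e.symm) (e x) := rfl

lemma laplacian_laplacian_eq_chartLap (g : Metric E M) (e : OpenPartialHomeomorph M E) (f : M → F)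
    {x : M} (hx : x ∈ e.source) : laplacian g e (laplacian g e f) x =
      chartLap g e (chartLap g e (f ∘ e.symm)) (e x) := by
  rw [laplacian_eq_chartLap]
  refine divOp_congr_of_eqOn e.open_target (fun y hy => ?_) (e.map_source hx)
  simp [laplacian_eq_chartLap, e.right_inv hy]

end Chart

/-! ### Flat metrics and harmonic functions on the plane. -/

section Flat

variable {E : Type*} [NormedAddCommGroup E] [InnerProductSpace ℝ E] [FiniteDimensional ℝ E]
  {E' : Type*} [NormedAddCommGroup E'] [InnerProductSpace ℝ E'] [FiniteDimensional ℝ E']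
  {F : Type*} [NormedAddCommGroup F] [NormedSpace ℝ F]

lemma gram_flat (y : E) : gram (flat E) (OpenPartialHomeomorph.refl E) y = 1 := by
  ext i j
  have h : mfderiv 𝓘(ℝ, E) 𝓘(ℝ, E) (OpenPartialHomeomorph.refl E).symm y =
      ContinuousLinearMap.id ℝ E := mfderiv_id
  have h' : gram (flat E) (OpenPartialHomeomorph.refl E) y i j =
      inner ℝ (stdOrthonormalBasis ℝ E i) (stdOrthonormalBasis ℝ E j) := by
    simp only [gram, Matrix.of_apply, h]
    rfl
  rw [h', Matrix.one_apply, orthonormal_iff_ite.1 (stdOrthonormalBasis ℝ E).orthonormal]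

lemma gradForm_flat (u w : E → ℂ) (z : E) :
    chartGradForm (flat E) (OpenPartialHomeomorph.refl E) u w z =
      ∑ i, fderiv ℝ u z (stdOrthonormalBasis ℝ E i) * fderiv ℝ w z (stdOrthonormalBasis ℝ E i) := by
  simp [gradForm, gram_flat, Matrix.one_apply]

lemma laplacian_flat {f : E → F} {x : E} (hf : ContDiffAt ℝ 2 f x) :
    laplacian (flat E) (OpenPartialHomeomorph.refl E) f x = Laplacian.laplacian f x := by
  have hd : DifferentiableAt ℝ (fderiv ℝ f) x :=
    (hf.fderiv_right (m := 1) (by norm_num)).differentiableAt (by simp)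
  have hw : ∀ w, fderiv ℝ (fun y => fderiv ℝ f y w) x = (fderiv ℝ (fderiv ℝ f) x).flip w :=
    fun w => by simp [fderiv_clm_apply hd (differentiableAt_const w)]
  have hij : ∀ i j, fderiv ℝ (fun z => (1 : Matrix (Fin (Module.finrank ℝ E)) _ ℝ) i j •
      fderiv ℝ f z (stdOrthonormalBasis ℝ E j)) x (stdOrthonormalBasis ℝ E i) =
      if i = j then fderiv ℝ (fderiv ℝ f) x (stdOrthonormalBasis ℝ E i)
        (stdOrthonormalBasis ℝ E i) else 0 := by
    intro i j
    rw [Matrix.one_apply]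
    split_ifs with h
    · subst h
      simp [hw]
    · simp
  rw [InnerProductSpace.laplacian_eq_iteratedFDeriv_stdOrthonormalBasis]
  simp only [laplacian, gram_flat, Matrix.det_one, Real.sqrt_one, inv_one, one_smul, one_mul,
    iteratedFDeriv_two_apply]
  simp [hij]

lemma laplacian_comp_linearIsometryEquiv (T : E ≃ₗᵢ[ℝ] E') (f : E' → F) (x : E) :
    Laplacian.laplacian (f ∘ T) x = Laplacian.laplacian f (T x) := by
  have h := T.toContinuousLinearEquiv.iteratedFDerivWithin_comp_right f uniqueDiffOn_univ
    (Set.mem_univ (T x)) 2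
  simp only [Set.preimage_univ, iteratedFDerivWithin_univ] at h
  rw [InnerProductSpace.laplacian_eq_iteratedFDeriv_orthonormalBasis _ (stdOrthonormalBasis ℝ E),
    InnerProductSpace.laplacian_eq_iteratedFDeriv_orthonormalBasis _ ((stdOrthonormalBasis ℝ E).map T)]
  refine Finset.sum_congr rfl fun i _ => ?_
  refine (DFunLike.congr_fun h _).trans ?_
  rw [ContinuousMultilinearMap.compContinuousLinearMap_apply]
  congr 1
  ext k
  fin_cases k <;> simp

/-- A harmonic function on a Euclidean plane is locally the real part of a holomorphic function. -/
lemma HarmonicOn.exists_holomorphic (T : E' ≃ₗᵢ[ℝ] ℂ) {f : E' → ℝ} {W : Set E'} (hW : IsOpen W)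
    (hf : HarmonicOn (flat E') f W) {w : E'} (hw : w ∈ W) :
    ∃ B : Set ℂ, IsOpen B ∧ T w ∈ B ∧ ∃ p : ℂ → ℂ, DifferentiableOn ℂ p B ∧
      ∀ y, T y ∈ B → y ∈ W ∧ f y = (p (T y)).re := by
  have hcd : ∀ y ∈ W, ContDiffAt ℝ 2 f y := fun y hy =>
    ((contMDiffOn_iff_contDiffOn.1 hf.1).contDiffAt (hW.mem_nhds hy)).of_le
      (WithTop.coe_le_coe.2 le_top)
  have hS : IsOpen (T.symm ⁻¹' W) := hW.preimage T.symm.continuous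
  have hharm : InnerProductSpace.HarmonicOnNhd (f ∘ T.symm) (T.symm ⁻¹' W) := by
    intro z hz
    refine ⟨(hcd _ hz).comp z T.symm.contDiff.contDiffAt, ?_⟩
    filter_upwards [hS.mem_nhds hz] with y hy
    rw [laplacian_comp_linearIsometryEquiv, ← laplacian_flat (hcd _ hy)]
    exact hf.2 _ (chartedSpaceSelf_atlas.2 rfl) _ ⟨hy, Set.mem_univ _⟩
  obtain ⟨R, hR, hball⟩ := Metric.isOpen_iff.1 hS (T w) (by simpa using hw)
  -- Restricting to a ball is what guarantees a harmonic conjugate; `W` itself may have holes.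
  obtain ⟨p, hp, hpe⟩ := (hharm.mono hball).exists_analyticOnNhd_ball_re_eq
  refine ⟨Metric.ball (T w) R, Metric.isOpen_ball, Metric.mem_ball_self hR, p,
    hp.differentiableOn, fun y hy => ⟨by simpa using hball hy, ?_⟩⟩
  simpa using (hpe hy).symm

lemma harmonicOn_re_entire (T : E' ≃ₗᵢ[ℝ] ℂ) {p : ℂ → ℂ} (hp : Differentiable ℂ p) :
    HarmonicOn (flat E') (fun y => (p (T y)).re) Set.univ := by
  have hcd : ContDiff ℝ ∞ (fun y : E' => (p (T y)).re) :=
    Complex.reCLM.contDiff.comp ((hp.contDiff.restrict_scalars ℝ).comp T.contDiff)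
  refine ⟨hcd.contMDiff.contMDiffOn, fun e he x _ => ?_⟩
  rw [chartedSpaceSelf_atlas] at he
  subst he
  rw [laplacian_flat (hcd.contDiffAt.of_le (WithTop.coe_le_coe.2 le_top))]
  exact (laplacian_comp_linearIsometryEquiv T (fun z => (p z).re) x).trans
    (hp.analyticAt (T x)).harmonicAt_re.2.self_of_nhds

end Flat

/-! ### Linear algebra of horizontal conformality. -/

section Conformal

variable {E : Type*} [NormedAddCommGroup E] [InnerProductSpace ℝ E] [FiniteDimensional ℝ E]

/-- A linear map to the plane is conformal on the orthogonal complement of its kernel if and only if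
its components are orthogonal and of the same length. -/
lemma sum_sq_eq_zero_iff {ι : Type*} [Fintype ι] (b : OrthonormalBasis ι ℝ E) (D : E →L[ℝ] ℂ) :
    ∑ i, D (b i) * D (b i) = 0 ↔ D = 0 ∨ (Function.Surjective D ∧ ∃ Λ : ℝ, 0 < Λ ∧ ∀ X Y : E,
      (∀ Z, D Z = 0 → inner ℝ X Z = 0) → (∀ Z, D Z = 0 → inner ℝ Y Z = 0) →
        inner ℝ (D X) (D Y) = Λ * inner ℝ X Y) := by
  -- `α` and `β` are the gradients of the real and imaginary parts. The sum of squares is `|α|² -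
  -- |β|² + 2i⟨α, β⟩`, and both vectors are orthogonal to `ker D`.
  set α : E := (InnerProductSpace.toDual ℝ E).symm (Complex.reCLM.comp D) with hα
  set β : E := (InnerProductSpace.toDual ℝ E).symm (Complex.imCLM.comp D) with hβ
  have hre : ∀ x, (D x).re = inner ℝ α x := fun x => by simp [hα]
  have him : ∀ x, (D x).im = inner ℝ β x := fun x => by simp [hβ]
  have hD : ∀ x, D x = 0 ↔ inner ℝ α x = 0 ∧ inner ℝ β x = 0 := fun x => by
    rw [Complex.ext_iff, hre, him]; rfl
  have hin : ∀ x y, inner ℝ (D x) (D y) = inner ℝ α x * inner ℝ α y + inner ℝ β x * inner ℝ β y :=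
    fun x y => by
      rw [Complex.inner, Complex.mul_re]
      simp only [Complex.conj_re, Complex.conj_im, hre, him]
      ring
  have hsum : ∑ i, D (b i) * D (b i) = 0 ↔ inner ℝ α α = inner ℝ β β ∧ inner ℝ α β = 0 := by
    rw [Complex.ext_iff, Complex.re_sum, Complex.im_sum]
    simp only [Complex.mul_re, Complex.mul_im, hre, him, Finset.sum_sub_distrib,
      Finset.sum_add_distrib, Complex.zero_re, Complex.zero_im, sub_eq_zero]
    have h : ∀ x y : E, ∑ i, inner ℝ x (b i) * inner ℝ y (b i) = inner ℝ x y := fun x y => by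
      simpa only [real_inner_comm y] using b.sum_inner_mul_inner x y
    rw [h, h, h, h, real_inner_comm α β]
    constructor <;> rintro ⟨h1, h2⟩ <;> exact ⟨h1, by linarith⟩
  have hαk : ∀ Z, D Z = 0 → inner ℝ α Z = 0 := fun Z hZ => ((hD Z).1 hZ).1
  have hβk : ∀ Z, D Z = 0 → inner ℝ β Z = 0 := fun Z hZ => ((hD Z).1 hZ).2
  rw [hsum]
  constructor
  · rintro ⟨h1, h2⟩
    by_cases hα0 : α = 0
    · left
      have hβ0 : β = 0 := by rw [← inner_self_eq_zero (𝕜 := ℝ), ← h1, hα0, inner_zero_left]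
      ext x
      simp [hD, hα0, hβ0]
    right
    have hL : 0 < inner ℝ α α := real_inner_self_pos.2 hα0
    have h2' : inner ℝ β α = 0 := by rw [real_inner_comm, h2]
    refine ⟨fun c => ⟨(c.re / inner ℝ α α) • α + (c.im / inner ℝ α α) • β, ?_⟩,
      inner ℝ α α, hL, fun X Y hX hY => ?_⟩
    · apply Complex.ext
      · rw [hre]
        simp only [inner_add_right, inner_smul_right, h2]
        field_simp
        simp
      · rw [him]
        simp only [inner_add_right, inner_smul_right, h2', ← h1]
        field_simp
        simp
    -- `|α|²` times the projection of `X` to `ker D`, scaled to avoid division; a horizontal `Y` is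
    -- orthogonal to it.
    · set Z : E := inner ℝ α α • X - (inner ℝ α X • α + inner ℝ β X • β) with hZ
      have hZ0 : D Z = 0 := by
        rw [hD]
        constructor
        · simp only [hZ, inner_sub_right, inner_add_right, inner_smul_right, h2]
          ring
        · simp only [hZ, inner_sub_right, inner_add_right, inner_smul_right, h2', ← h1]
          ring
      have := hY Z hZ0
      simp only [hZ, inner_sub_right, inner_add_right, inner_smul_right] at this
      rw [real_inner_comm X Y, real_inner_comm α Y, real_inner_comm β Y] at this
      rw [hin]
      linarith
  · rintro (rfl | ⟨hs, Λ, hΛ, h⟩)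
    · have hα0 : α = 0 := by simp [hα]
      have hβ0 : β = 0 := by simp [hβ]
      simp [hα0, hβ0]
    have hαα := h α α hαk hαk
    have hββ := h β β hβk hβk
    have hαβ := h α β hαk hβk
    rw [hin] at hαα hββ hαβ
    obtain ⟨X, hX⟩ := hs 1
    obtain ⟨Y, hY⟩ := hs Complex.I
    have hαX : inner ℝ α X = 1 := by rw [← hre, hX]; rfl
    have hβX : inner ℝ β X = 0 := by rw [← him, hX]; rfl
    have hβY : inner ℝ β Y = 1 := by rw [← him, hY]; rfl
    have hα0 : α ≠ 0 := fun h0 => by simp [h0] at hαX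
    have hβ0 : β ≠ 0 := fun h0 => by simp [h0] at hβY
    have ha := real_inner_self_pos.2 hα0
    have hb := real_inner_self_pos.2 hβ0
    have hcomm : inner ℝ β α = inner ℝ α β := real_inner_comm _ _
    -- If `⟨α, β⟩ ≠ 0`, the mixed relation gives `|α|² + |β|² = Λ`. The relation for `α` then
    -- becomes equality in Cauchy–Schwarz, so `α` and `β` are dependent, against surjectivity.
    have hc : inner ℝ α β = 0 := by
      by_contra hc
      have hsum : inner ℝ α α + inner ℝ β β = Λ := by
        apply mul_right_cancel₀ hc
        rw [hcomm] at hαβ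
        linear_combination hαβ
      have hcs : inner ℝ α β * inner ℝ α β = inner ℝ α α * inner ℝ β β := by
        rw [hcomm] at hαα
        rw [← hsum] at hαα
        linarith
      have hw : inner ℝ β β • α - inner ℝ α β • β = 0 := by
        rw [← inner_self_eq_zero (𝕜 := ℝ)]
        simp only [inner_sub_left, inner_sub_right, inner_smul_left, inner_smul_right, hcomm,
          RCLike.conj_to_real]
        linear_combination (-inner ℝ β β) * hcs
      have := congrArg (fun y => inner ℝ y X) hw
      simp only [inner_sub_left, inner_smul_left, hαX, hβX, inner_zero_left,
        RCLike.conj_to_real] at this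
      linarith
    refine ⟨?_, hc⟩
    rw [hcomm, hc] at hαα
    rw [hc] at hββ
    have e1 : inner ℝ α α = Λ := by
      apply mul_right_cancel₀ ha.ne'
      linarith
    have e2 : inner ℝ β β = Λ := by
      apply mul_right_cancel₀ hb.ne'
      linarith
    rw [e1, e2]

end Conformal

/-! ### Morphism conditions expressed in charts. -/

section Morphism

variable {E : Type*} [NormedAddCommGroup E] [InnerProductSpace ℝ E] [FiniteDimensional ℝ E]
  {M : Type*} [TopologicalSpace M] [ChartedSpace E M] [IsManifold 𝓘(ℝ, E) ∞ M]
  {E' : Type*} [NormedAddCommGroup E'] [InnerProductSpace ℝ E'] [FiniteDimensional ℝ E']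
  {g : Metric E M} {φ : M → E'} {U : Set M} {e : OpenPartialHomeomorph M E}

lemma contDiffOn_chart (he : e ∈ atlas E M) (hφ : ContMDiffOn 𝓘(ℝ, E) 𝓘(ℝ, E') ∞ φ U)
    (T : E' ≃ₗᵢ[ℝ] ℂ) : ContDiffOn ℝ ∞ (fun y => T (φ (e.symm y))) (e.target ∩ e.symm ⁻¹' U) := by
  have hs : ContMDiffOn 𝓘(ℝ, E) 𝓘(ℝ, E) ∞ e.symm e.target :=
    contMDiffOn_symm_of_mem_maximalAtlas (IsManifold.subset_maximalAtlas he)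
  have h : ContMDiffOn 𝓘(ℝ, E) 𝓘(ℝ, E') ∞ (φ ∘ e.symm) (e.target ∩ e.symm ⁻¹' U) :=
    hφ.comp (hs.mono Set.inter_subset_left) fun y hy => hy.2
  exact T.contDiff.comp_contDiffOn (contMDiffOn_iff_contDiffOn.1 h)

/-- Entire functions of a generalized harmonic morphism to the plane are biharmonic. -/
lemma GeneralizedHarmonicMorphismOn.chartLap_chartLap_entire (T : E' ≃ₗᵢ[ℝ] ℂ) (hU : IsOpen U)
    (hφ : GeneralizedHarmonicMorphismOn g (flat E') φ U) (he : e ∈ atlas E M) {p : ℂ → ℂ}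
    (hp : Differentiable ℂ p) {y : E} (hy : y ∈ e.target ∩ e.symm ⁻¹' U) :
    chartLap g e (chartLap g e fun y => p (T (φ (e.symm y)))) y = 0 := by
  have hc := (smoothCoeff_gram g he).mono (e.symm.isOpen_inter_preimage hU) Set.inter_subset_left
  have hψ := contDiffOn_chart he hφ.1 T
  have key : ∀ q : ℂ → ℂ, Differentiable ℂ q →
      (chartLap g e (chartLap g e fun y => q (T (φ (e.symm y)))) y).re = 0 := by
    intro q hq
    have hqψ := contDiffOn_holomorphic_comp hψ isOpen_univ (Set.mapsTo_univ _ _) hq.differentiableOn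
    have h := (hφ.2 Set.univ _ isOpen_univ (harmonicOn_re_entire T hq)).2 e he (e.symm y)
      ⟨⟨hy.2, Set.mem_univ _⟩, e.map_target hy.1⟩
    rw [laplacian_laplacian_eq_chartLap _ _ _ (e.map_target hy.1), e.right_inv hy.1] at h
    rw [← h]
    refine (hc.divOp_clm_comp (hc.contDiffOn_divOp hqψ) Complex.reCLM hy).symm.trans ?_
    exact divOp_congr_of_eqOn hc.isOpen
      (fun z hz => (hc.divOp_clm_comp hqψ Complex.reCLM hz).symm) hy
  refine Complex.ext (key p hp) ?_
  -- The imaginary part of `p` is the real part of `-i p`, which is also entire.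
  have h := key (fun z => -Complex.I * p z) (hp.const_mul _)
  have hpψ := contDiffOn_holomorphic_comp hψ isOpen_univ (Set.mapsTo_univ _ _) hp.differentiableOn
  set m : ℂ →L[ℝ] ℂ := ContinuousLinearMap.mul ℝ ℂ (-Complex.I) with hm
  have h1 : chartLap g e (chartLap g e fun y => -Complex.I * p (T (φ (e.symm y)))) y =
      m (chartLap g e (chartLap g e fun y => p (T (φ (e.symm y)))) y) := by
    rw [← hc.divOp_clm_comp (hc.contDiffOn_divOp hpψ) m hy]
    exact divOp_congr_of_eqOn hc.isOpen (fun z hz => hc.divOp_clm_comp hpψ m hz) hy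
  rw [h1] at h
  simpa [hm] using h

/-- The test polynomial is a fourth power centred at the value of the map at the given point, so it
changes with the point. -/
lemma GeneralizedHarmonicMorphismOn.chartGradForm_eq_zero (T : E' ≃ₗᵢ[ℝ] ℂ) (hU : IsOpen U)
    (hφ : GeneralizedHarmonicMorphismOn g (flat E') φ U) (he : e ∈ atlas E M)
    {y : E} (hy : y ∈ e.target ∩ e.symm ⁻¹' U) :
    chartGradForm g e (fun y => T (φ (e.symm y))) (fun y => T (φ (e.symm y))) y = 0 :=
  ((smoothCoeff_gram g he).mono (e.symm.isOpen_inter_preimage hU)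
    Set.inter_subset_left).gradForm_self_eq_zero (contDiffOn_chart he hφ.1 T) hy (hφ.chartLap_chartLap_entire T hU he
      (p := fun z => (z - T (φ (e.symm y))) ^ 4) (by fun_prop) hy)

/-- In a chart, the pull-back of a harmonic function on the plane is locally the real part of a
holomorphic function of the map. -/
lemma exists_pullback_eq_re_holomorphic (T : E' ≃ₗᵢ[ℝ] ℂ) (hU : IsOpen U)
    (hφ : ContMDiffOn 𝓘(ℝ, E) 𝓘(ℝ, E') ∞ φ U) (he : e ∈ atlas E M) {W : Set E'} (hW : IsOpen W)
    {f : E' → ℝ} (hf : HarmonicOn (flat E') f W) {x : M} (hx : x ∈ (U ∩ φ ⁻¹' W) ∩ e.source) :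
    ∃ O ⊆ e.target ∩ e.symm ⁻¹' U, IsOpen O ∧ e x ∈ O ∧ ∃ B : Set ℂ, IsOpen B ∧
      Set.MapsTo (fun y => T (φ (e.symm y))) O B ∧ ∃ p : ℂ → ℂ, DifferentiableOn ℂ p B ∧
        O.EqOn (f ∘ φ ∘ e.symm) (fun y => (p (T (φ (e.symm y)))).re) := by
  obtain ⟨B, hB, hxB, p, hp, hfp⟩ := hf.exists_holomorphic T hW hx.1.2
  refine ⟨(e.target ∩ e.symm ⁻¹' U) ∩ (fun y => T (φ (e.symm y))) ⁻¹' B, Set.inter_subset_left,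
    (contDiffOn_chart he hφ T).continuousOn.isOpen_inter_preimage (e.symm.isOpen_inter_preimage hU) hB,
    ?_, B, hB, fun y hy => hy.2, p, hp, fun y hy => (hfp _ hy.2).2⟩
  simpa [e.left_inv hx.2, e.map_source hx.2, hx.1.1] using hxB

lemma contMDiffOn_pullback (hφ : ContMDiffOn 𝓘(ℝ, E) 𝓘(ℝ, E') ∞ φ U) {W : Set E'}
    {f : E' → ℝ} (hf : HarmonicOn (flat E') f W) :
    ContMDiffOn 𝓘(ℝ, E) 𝓘(ℝ, ℝ) ∞ (f ∘ φ) (U ∩ φ ⁻¹' W) :=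
  hf.1.comp (hφ.mono Set.inter_subset_left) fun _ hx => hx.2

lemma HarmonicMorphismOn.of_chartLap_eq_zero (T : E' ≃ₗᵢ[ℝ] ℂ) (hU : IsOpen U)
    (hφ : ContMDiffOn 𝓘(ℝ, E) 𝓘(ℝ, E') ∞ φ U)
    (hQ : ∀ e ∈ atlas E M, ∀ y ∈ e.target ∩ e.symm ⁻¹' U,
      chartGradForm g e (fun y => T (φ (e.symm y))) (fun y => T (φ (e.symm y))) y = 0)
    (hL : ∀ e ∈ atlas E M, ∀ y ∈ e.target ∩ e.symm ⁻¹' U,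
      chartLap g e (fun y => T (φ (e.symm y))) y = 0) :
    HarmonicMorphismOn g (flat E') φ U := by
  refine ⟨hφ, fun W f hW hf => ⟨contMDiffOn_pullback hφ hf, fun e he x hx => ?_⟩⟩
  obtain ⟨O, hOe, hO, hxO, B, hB, hOB, p, hp, hfp⟩ :=
    exists_pullback_eq_re_holomorphic T hU hφ he hW hf hx
  have hc := (smoothCoeff_gram g he).mono hO (hOe.trans Set.inter_subset_left)
  have hψ := (contDiffOn_chart he hφ T).mono hOe
  rw [laplacian_eq_chartLap]
  refine (divOp_congr_of_eqOn hO hfp hxO).trans ?_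
  refine (hc.divOp_clm_comp (contDiffOn_holomorphic_comp hψ hB hOB hp) Complex.reCLM hxO).trans ?_
  have h1 := hL e he _ (hOe hxO)
  have h2 := hQ e he _ (hOe hxO)
  rw [chartLap] at h1
  rw [chartGradForm] at h2
  rw [hc.divOp_holomorphic_comp hψ hB hOB hp hxO, h1, h2]
  simp

lemma GeneralizedHarmonicMorphismOn.of_chartLap_eq_zero (T : E' ≃ₗᵢ[ℝ] ℂ) (hU : IsOpen U)
    (hφ : ContMDiffOn 𝓘(ℝ, E) 𝓘(ℝ, E') ∞ φ U)
    (hQ : ∀ e ∈ atlas E M, ∀ y ∈ e.target ∩ e.symm ⁻¹' U,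
      chartGradForm g e (fun y => T (φ (e.symm y))) (fun y => T (φ (e.symm y))) y = 0)
    (h1 : ∀ e ∈ atlas E M, ∀ y ∈ e.target ∩ e.symm ⁻¹' U,
      chartLap g e (chartLap g e (fun y => T (φ (e.symm y)))) y = 0)
    (h2 : ∀ e ∈ atlas E M, ∀ y ∈ e.target ∩ e.symm ⁻¹' U,
      chartLap g e (chartLap g e (fun y => T (φ (e.symm y)) ^ 2)) y = 0) :
    GeneralizedHarmonicMorphismOn g (flat E') φ U := by
  refine ⟨hφ, fun W f hW hf => ⟨contMDiffOn_pullback hφ hf, fun e he x hx => ?_⟩⟩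
  obtain ⟨O, hOe, hO, hxO, B, hB, hOB, p, hp, hfp⟩ :=
    exists_pullback_eq_re_holomorphic T hU hφ he hW hf hx
  have hc := (smoothCoeff_gram g he).mono hO (hOe.trans Set.inter_subset_left)
  have hψ := (contDiffOn_chart he hφ T).mono hOe
  have hpψ := contDiffOn_holomorphic_comp hψ hB hOB hp
  rw [laplacian_laplacian_eq_chartLap _ _ _ hx.2]
  refine (divOp_congr_of_eqOn hO (fun y hy => (divOp_congr_of_eqOn hO hfp hy).trans
    (hc.divOp_clm_comp hpψ Complex.reCLM hy)) hxO).trans ?_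
  refine (hc.divOp_clm_comp (hc.contDiffOn_divOp hpψ) Complex.reCLM hxO).trans ?_
  rw [hc.divOp_divOp_holomorphic_comp_eq_zero hψ (fun y hy => hQ e he y (hOe hy)) hB hOB hp hxO
    (h1 e he _ (hOe hxO)) (h2 e he _ (hOe hxO)), map_zero]

end Morphism

/-! ### Part (a): surfaces. -/

section Surface

/-- The size `n` is kept variable because the Gram matrix is indexed by `finrank`, which equals `2`
only propositionally. -/
lemma divOp_eq_zero_of_posDef_of_gradForm_self_eq_zero {E : Type*} [NormedAddCommGroup E]
    [NormedSpace ℝ E] {n : ℕ} (hn : n = 2) {G : E → Matrix (Fin n) (Fin n) ℝ} {v : Fin n → E}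
    {O : Set E} (hc : SmoothCoeff (fun z => (√(G z).det)⁻¹) (fun z => √(G z).det • (G z)⁻¹) O)
    (hpos : ∀ z ∈ O, (G z).PosDef) {u : E → ℂ} (hu : ContDiffOn ℝ ∞ u O)
    (hQ : ∀ z ∈ O, gradForm (fun z => (√(G z).det)⁻¹) (fun z => √(G z).det • (G z)⁻¹) v u u z = 0)
    {z : E} (hz : z ∈ O) :
    divOp (fun z => (√(G z).det)⁻¹) (fun z => √(G z).det • (G z)⁻¹) v u z = 0 := by
  subst hn
  exact hc.divOp_eq_zero_of_gradForm_self_eq_zero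
    (fun z hz => inv_ne_zero (Real.sqrt_pos.2 (hpos z hz).det_pos).ne')
    (fun z hz => det_sqrt_det_smul_inv (hpos z hz).det_pos) hu hQ hz

/-- On a surface, every generalized harmonic morphism to the Euclidean plane is a harmonic
morphism. -/
theorem GeneralizedHarmonicMorphismOn.harmonicMorphismOn
    {E : Type*} [NormedAddCommGroup E] [InnerProductSpace ℝ E] [FiniteDimensional ℝ E]
    {M : Type*} [TopologicalSpace M] [ChartedSpace E M] [IsManifold 𝓘(ℝ, E) ∞ M]
    {E' : Type*} [NormedAddCommGroup E'] [InnerProductSpace ℝ E'] [FiniteDimensional ℝ E']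
    {g : Metric E M} {φ : M → E'} {U : Set M} (hE : Module.finrank ℝ E = 2) (T : E' ≃ₗᵢ[ℝ] ℂ)
    (hU : IsOpen U) (hφ : GeneralizedHarmonicMorphismOn g (flat E') φ U) :
    HarmonicMorphismOn g (flat E') φ U := by
  have hQ : ∀ e ∈ atlas E M, ∀ y ∈ e.target ∩ e.symm ⁻¹' U,
      chartGradForm g e (fun y => T (φ (e.symm y))) (fun y => T (φ (e.symm y))) y = 0 :=
    fun e he y hy => hφ.chartGradForm_eq_zero T hU he hy
  refine HarmonicMorphismOn.of_chartLap_eq_zero T hU hφ.1 hQ fun e he y hy => ?_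
  exact divOp_eq_zero_of_posDef_of_gradForm_self_eq_zero hE
    ((smoothCoeff_gram g he).mono (e.symm.isOpen_inter_preimage hU) Set.inter_subset_left)
    (fun z hz => posDef_gram g he hz.1) (contDiffOn_chart he hφ.1 T) (hQ e he) hy

end Surface

/-! ### Part (b): Euclidean domains. -/

section EuclideanDomain

variable {E : Type*} [NormedAddCommGroup E] [InnerProductSpace ℝ E] [FiniteDimensional ℝ E]
  {U : Set E} {φ : E → ℂ}

lemma horizontallyWeaklyConformalOn_flat_iff :
    HorizontallyWeaklyConformalOn (flat E) (flat ℂ) φ U ↔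
      ContMDiffOn 𝓘(ℝ, E) 𝓘(ℝ, ℂ) ∞ φ U ∧
        ∀ x ∈ U, chartGradForm (flat E) (OpenPartialHomeomorph.refl E) φ φ x = 0 := by
  refine and_congr_right fun _ => forall₂_congr fun x _ => ?_
  rw [gradForm_flat, sum_sq_eq_zero_iff]
  rw [mfderiv_eq_fderiv]
  exact Iff.rfl

/-- A map from an open subset of a Euclidean space to the plane is a generalized harmonic morphism
if and only if it is horizontally weakly conformal and it and its square are biharmonic. -/
theorem generalizedHarmonicMorphismOn_flat_iff (hU : IsOpen U) :
    GeneralizedHarmonicMorphismOn (flat E) (flat ℂ) φ U ↔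
      HorizontallyWeaklyConformalOn (flat E) (flat ℂ) φ U ∧ BiharmonicOn (flat E) φ U ∧
        BiharmonicOn (flat E) (fun x => φ x ^ 2) U := by
  rw [horizontallyWeaklyConformalOn_flat_iff]
  have hmem : OpenPartialHomeomorph.refl E ∈ atlas E E := chartedSpaceSelf_atlas.2 rfl
  have hsq : ContMDiffOn 𝓘(ℝ, E) 𝓘(ℝ, ℂ) ∞ φ U →
      ContMDiffOn 𝓘(ℝ, E) 𝓘(ℝ, ℂ) ∞ (fun x => φ x ^ 2) U := fun h => by
    rw [contMDiffOn_iff_contDiffOn] at h ⊢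
    exact h.pow 2
  constructor
  · intro h
    have hent : ∀ p : ℂ → ℂ, Differentiable ℂ p → ∀ e ∈ atlas E E, ∀ x ∈ U ∩ e.source,
        laplacian (flat E) e (laplacian (flat E) e fun y => p (φ y)) x = 0 := by
      intro p hp e he x hx
      rw [laplacian_laplacian_eq_chartLap _ _ _ hx.2]
      exact h.chartLap_chartLap_entire (LinearIsometryEquiv.refl ℝ ℂ) hU he hp
        ⟨e.map_source hx.2, by simpa [e.left_inv hx.2] using hx.1⟩
    exact ⟨⟨h.1, fun x hx => h.chartGradForm_eq_zero (LinearIsometryEquiv.refl ℝ ℂ) hU hmem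
      ⟨Set.mem_univ x, hx⟩⟩, ⟨h.1, hent (fun z => z) (by fun_prop)⟩,
      ⟨hsq h.1, hent (fun z => z ^ 2) (by fun_prop)⟩⟩
  · rintro ⟨⟨hφ, hQ⟩, h1, h2⟩
    have hbi : ∀ f : E → ℂ, BiharmonicOn (flat E) f U → ∀ e ∈ atlas E E,
        ∀ y ∈ e.target ∩ e.symm ⁻¹' U,
          chartLap (flat E) e (chartLap (flat E) e fun y => f (e.symm y)) y = 0 := by
      intro f hf e he y hy
      have h := hf.2 e he (e.symm y) ⟨hy.2, e.map_target hy.1⟩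
      rwa [laplacian_laplacian_eq_chartLap _ _ _ (e.map_target hy.1), e.right_inv hy.1] at h
    refine GeneralizedHarmonicMorphismOn.of_chartLap_eq_zero (LinearIsometryEquiv.refl ℝ ℂ) hU hφ
      -- The atlas of a Euclidean space contains only the identity chart, where isotropy is already
      -- known.
      (fun e he y hy => ?_) (hbi φ h1) (hbi (fun x => φ x ^ 2) h2)
    rw [chartedSpaceSelf_atlas] at he
    subst he
    exact hQ y hy.2

end EuclideanDomain

end HarmMorph

end

theorem corollary2p6 :
    (∀ (M : Type*) [TopologicalSpace M] [ChartedSpace (EuclideanSpace ℝ (Fin 2)) M]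
        [IsManifold (𝓡 2) ∞ M] (g : HarmMorph.Metric (EuclideanSpace ℝ (Fin 2)) M)
        (φ : M → EuclideanSpace ℝ (Fin 2)),
      HarmMorph.GeneralizedHarmonicMorphismOn g
          (HarmMorph.flat (EuclideanSpace ℝ (Fin 2))) φ Set.univ →
        HarmMorph.HarmonicMorphismOn g
          (HarmMorph.flat (EuclideanSpace ℝ (Fin 2))) φ Set.univ) ∧
    (∀ (U : Set (EuclideanSpace ℝ (Fin 3))) (φ : EuclideanSpace ℝ (Fin 3) → ℂ), IsOpen U →
      (HarmMorph.GeneralizedHarmonicMorphismOn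
          (HarmMorph.flat (EuclideanSpace ℝ (Fin 3))) (HarmMorph.flat ℂ) φ U ↔
        HarmMorph.HorizontallyWeaklyConformalOn
            (HarmMorph.flat (EuclideanSpace ℝ (Fin 3))) (HarmMorph.flat ℂ) φ U ∧
          HarmMorph.BiharmonicOn (HarmMorph.flat (EuclideanSpace ℝ (Fin 3))) φ U ∧
          HarmMorph.BiharmonicOn (HarmMorph.flat (EuclideanSpace ℝ (Fin 3)))
            (fun x => φ x ^ 2) U)) := by
  refine ⟨fun M _ _ _ g φ hφ => ?_, fun U φ hU => ?_⟩
  -- The orthonormal basis `1, i` identifies the target plane isometrically with `ℂ`.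
  · exact hφ.harmonicMorphismOn finrank_euclideanSpace_fin Complex.orthonormalBasisOneI.repr.symm
      isOpen_univ
  · exact HarmMorph.generalizedHarmonicMorphismOn_flat_iff hU
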